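/- For $n\ge 1$ let $\xi_n=e^{2\pi i/n}$. For a sequence $A=[a_0,\dots,a_{\ell-1}]\in\mathbb{C}^\ell$, $\ell\ge 1$, with indices read modulo $\ell$, put $$\operatorname{PAF}(A,s)=\sum_{j=0}^{\ell-1}a_j\overline{a_{j+s}},\qquad \operatorname{DFT}(A,s)=\sum_{j=0}^{\ell-1}a_j\xi_\ell^{js},\qquad \operatorname{PSD}(A,s)=|\operatorname{DFT}(A,s)|^2 .$$ A quaternary Legendre pair of length $\ell$ is a pair $(A,B)$ with $A,B\in\{-1,+1,-i,+i\}^\ell$ and $\operatorname{PAF}(A,s)+\operatorname{PAF}(B,s)=-2$ for $s=1,\dots,\lfloor \ell/2\rfloor$. For $\gcd(k,n)=1$ let $\psi_k$ be the automorphism of $\mathbb{Q}(\xi_n)$ with $\psi_k(\xi_n)=\xi_n^k$, let $G_n$ be the group of all automorphisms of $\mathbb{Q}(\xi_n)$, and let $U_4=\{\psi_{4j+1}:\gcd(4j+1,n)=1\}$. The square-free part of a positive integer $m$ is the product of the primes that divide $m$ to an odd power; the square-free part of $0$ is taken to be $1$. Given $n$, say that an integer $m\ge 0$ satisfies condition $(\ast)$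 if for every prime divisor $p$ of the square-free part of $m$ we have $p=2$ or $p\equiv 1\bmod 4$, and, for every prime divisor $q>2$ of $n$, $p=q$ or the order of $p$ modulo $q$ is odd. **Theorem.** Let $(A,B)$ be a quaternary Legendre pair of length $\ell$, let $d>1$ be a divisor of $\ell$, and let $n=\operatorname{lcm}(4,d)$. Then $\operatorname{DFT}(A,\ell/d)$ and $\operatorname{PSD}(A,\ell/d)$ lie in $\mathbb{Q}(\xi_n)$, the absolute norm of $\operatorname{DFT}(A,\ell/d)$ from $\mathbb{Q}(\xi_n)$ to $\mathbb{Q}$ satisfies $$\prod_{\psi\in G_n}\psi\Bigl(\operatorname{DFT}\bigl(A,\tfrac{\ell}{d}\bigr)\Bigr)=\prod_{\psi\in U_4}\psi\Bigl(\operatorname{PSD}\bigl(A,\tfrac{\ell}{d}\bigr)\Bigr)=\prod_{\substack{0\le j\le n/4-1\\ \gcd(4j+1,n)=1}}\operatorname{PSD}\Bigl(A,(4j+1\bmod d)\tfrac{\ell}{d}\Bigr),$$ and this number is a non-negative integer that satisfies $(\ast)$. Suppose in addition that $d\equiv 0\bmod 4$. Then $\operatorname{DFT}(A,3\ell/d)$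 and $\operatorname{PSD}(A,3\ell/d)$ lie in $\mathbb{Q}(\xi_n)$, and both numbers $$P=\prod_{\substack{0\le j\le n/4-1\\ \gcd(4j+3,n)=1}}\operatorname{PSD}\Bigl(A,(4j+3\bmod d)\tfrac{\ell}{d}\Bigr)\quad\text{and}\quad N=\prod_{\psi\in G_n}\psi\Bigl(\operatorname{DFT}\bigl(A,3\tfrac{\ell}{d}\bigr)\Bigr)=\prod_{\psi\in U_4}\psi\Bigl(\operatorname{PSD}\bigl(A,3\tfrac{\ell}{d}\bigr)\Bigr)$$ are non-negative integers that satisfy $(\ast)$; moreover $P=N$ if $3\nmid d$. -/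

import Mathlib

/-- The primitive `n`-th root of unity `ξ_n = e^{2πi/n}`. -/
noncomputable def xi (n : ℕ) : ℂ := Complex.exp (2 * Real.pi * Complex.I / n)

/-- A quaternary sequence of period `ℓ`: all entries lie in `{-1, +1, -i, +i}`. -/
def IsQuaternary {ℓ : ℕ} (A : ZMod ℓ → ℂ) : Prop :=
  ∀ j, A j = 1 ∨ A j = -1 ∨ A j = Complex.I ∨ A j = -Complex.I

/-- The periodic autocorrelation function of `A` at lag `s`; indices are read modulo `ℓ`. -/
noncomputable def PAF {ℓ : ℕ} [NeZero ℓ] (A : ZMod ℓ → ℂ) (s : ℕ) : ℂ :=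
  ∑ j : ZMod ℓ, A j * starRingEnd ℂ (A (j + (s : ZMod ℓ)))

/-- `(A, B)` is a quaternary Legendre pair of length `ℓ`. -/
structure IsQuaternaryLegendrePair {ℓ : ℕ} [NeZero ℓ] (A B : ZMod ℓ → ℂ) : Prop where
  quaternary_left : IsQuaternary A
  quaternary_right : IsQuaternary B
  paf_add_paf : ∀ s ∈ Finset.Icc 1 (ℓ / 2), PAF A s + PAF B s = -2

/-- The discrete Fourier transform `DFT(A, s) = ∑_{j=0}^{ℓ-1} a_j ξ_ℓ^{js}`. -/
noncomputable def DFT {ℓ : ℕ} [NeZero ℓ] (A : ZMod ℓ → ℂ) (s : ℕ) : ℂ :=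
  ∑ j : ZMod ℓ, A j * xi ℓ ^ (j.val * s)

/-- The power spectral density `PSD(A, s) = |DFT(A, s)|²`. -/
noncomputable def PSD {ℓ : ℕ} [NeZero ℓ] (A : ZMod ℓ → ℂ) (s : ℕ) : ℝ :=
  ‖DFT A s‖ ^ 2

/-- The `n`-th cyclotomic field `ℚ(ξ_n)`, as a subfield of `ℂ`. -/
noncomputable abbrev Cyc (n : ℕ) : IntermediateField ℚ ℂ :=
  IntermediateField.adjoin ℚ {xi n}

theorem xi_isIntegral (n : ℕ) : IsIntegral ℚ (xi n) := by
  rcases Nat.eq_zero_or_pos n with h | h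
  · subst h
    simpa [xi] using (isIntegral_one : IsIntegral ℚ (1 : ℂ))
  · have h1 : xi n ^ n = 1 := (Complex.isPrimitiveRoot_exp n h.ne').pow_eq_one
    exact IsIntegral.of_pow h (h1 ▸ isIntegral_one)

instance Cyc.finiteDimensional (n : ℕ) : FiniteDimensional ℚ (Cyc n) :=
  IntermediateField.adjoin.finiteDimensional (xi_isIntegral n)

open Classical in
/-- The set `U_4 = {ψ_{4j+1} : gcd(4j+1, n) = 1}` of automorphisms of `ℚ(ξ_n)`, where
`ψ_k` is the automorphism with `ψ_k(ξ_n) = ξ_n^k`. -/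
noncomputable def U4 (n : ℕ) : Finset (Cyc n ≃ₐ[ℚ] Cyc n) :=
  Finset.univ.filter fun ψ => ∃ j : ℕ, Nat.gcd (4 * j + 1) n = 1 ∧
    ((ψ (IntermediateField.AdjoinSimple.gen ℚ (xi n)) : Cyc n) : ℂ) = xi n ^ (4 * j + 1)

/-- The square-free part of `m`: the product of the primes that divide `m` to an odd power.
For `m = 0` it is `1`. -/
def squarefreePart (m : ℕ) : ℕ :=
  ∏ p ∈ m.primeFactors.filter (fun p => Odd (m.factorization p)), p

/-- The restriction on the prime divisors `p` of the square-free part of `m`: `p = 2` or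
`p ≡ 1 mod 4`, and for every odd prime `q ∣ n`, either `p = q` or the order of `p` modulo `q`
is odd. -/
def RestrictedSquarefreePart (n m : ℕ) : Prop :=
  ∀ p : ℕ, p.Prime → p ∣ squarefreePart m →
    (p = 2 ∨ p ≡ 1 [MOD 4]) ∧
    ∀ q : ℕ, q.Prime → 2 < q → q ∣ n → p = q ∨ Odd (orderOf (p : ZMod q))

/-- The product of `PSD(A, (4j+s mod d) ℓ/d)` over `0 ≤ j ≤ n/4 - 1` with `gcd(4j+s, n) = 1`. -/
noncomputable def psdProd {ℓ : ℕ} [NeZero ℓ] (A : ZMod ℓ → ℂ) (d n s : ℕ) : ℝ :=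
  ∏ j ∈ (Finset.range (n / 4)).filter (fun j => Nat.gcd (4 * j + s) n = 1),
    PSD A ((4 * j + s) % d * (ℓ / d))

/-- `DFT(A, t)` and `PSD(A, t)` lie in `ℚ(ξ_n)`, and the absolute norm of `DFT(A, t)` from
`ℚ(ξ_n)`, i.e. the product of its images under all automorphisms, equals the product of the
images of `PSD(A, t)` under `U_4`, and is the integer `m`. -/
def NormDFTEq {ℓ : ℕ} [NeZero ℓ] (A : ZMod ℓ → ℂ) (n t m : ℕ) : Prop :=
  ∃ x y : Cyc n, (x : ℂ) = DFT A t ∧ (y : ℂ) = ((PSD A t : ℝ) : ℂ) ∧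
    Algebra.norm ℚ x = (m : ℚ) ∧
    ∏ ψ : Cyc n ≃ₐ[ℚ] Cyc n, ψ x = (m : Cyc n) ∧
    ∏ ψ ∈ U4 n, ψ y = (m : Cyc n)

/-! Since `4 ∣ n`, the group `G_n` is the disjoint union of `U_4`, which fixes `i`, and its coset
under complex conjugation `ψ_{-1}`. `G_n` is abelian, so the norm of `x` is the product of `|ψ x|²`
over `U_4`, hence non-negative. On a DFT with entries in `{±1, ±i}`, such a `ψ_k` only multiplies
the frequency by `k`, which gives the PSD products.

For the square-free part, let `r ∣ n` be prime to `p`. Every residue field of characteristic `p`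
contains the `r`-th roots of unity, so its degree is a multiple of the order of `p` modulo `r`. If
that order is even, `p` divides every nonzero ideal norm to an even power. Taking `r = 4` and `r =
q` gives the two conditions (`even_factorization_absNorm`).

The product over `4j+3` is the `4j+1` product of the conjugate sequence; if `3 ∤ d`, it is also the
norm at frequency `3`. -/

/-! ### Residue degrees and the square-free part of norms -/

open Polynomial in
-- As `r ≠ 0` in `F`, the image of `ζ` is still primitive, so `r` divides the order of the cyclic
-- group of units of `F`.
theorem IsPrimitiveRoot.orderOf_dvd_of_card_eq_pow {R F : Type*} [CommRing R] [IsDomain R]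
    [Field F] [Finite F] (φ : R →+* F) {r p f : ℕ} {ζ : R} (hr : 0 < r)
    (hζ : IsPrimitiveRoot ζ r) (hF : (r : F) ≠ 0) (hcard : Nat.card F = p ^ f) :
    orderOf (p : ZMod r) ∣ f := by
  have h1 : IsRoot (cyclotomic r F) (φ ζ) := by
    have h := hζ.isRoot_cyclotomic hr
    rw [← map_cyclotomic r φ]
    exact h.map
  have : NeZero (r : F) := ⟨hF⟩
  have h2 : IsPrimitiveRoot (φ ζ) r := isRoot_cyclotomic_iff.mp h1
  have := Fintype.ofFinite F
  have h3 : r ∣ p ^ f - 1 := by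
    rw [← hcard, Nat.card_eq_fintype_card]
    exact h2.dvd_of_pow_eq_one _ (FiniteField.pow_card_sub_one_eq_one _ (h2.ne_zero hr.ne'))
  have hpos : 1 ≤ p ^ f := hcard ▸ Nat.card_pos
  apply orderOf_dvd_of_pow_eq_one
  have h4 := (ZMod.natCast_eq_zero_iff _ _).mpr h3
  rw [Nat.cast_sub hpos, sub_eq_zero] at h4
  simpa using h4

/-- By multiplicativity, it suffices to treat a prime ideal: its norm is `c ^ f`, where `f` is even
if `c = p`, and `p` does not occur otherwise. -/
theorem even_factorization_absNorm {R : Type*} [CommRing R] [IsDedekindDomain R]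
    [Module.Free ℤ R] [Module.Finite ℤ R] {p r : ℕ} (hp : p.Prime) (hr : 0 < r)
    (hpr : p.Coprime r) {ζ : R} (hζ : IsPrimitiveRoot ζ r)
    (heven : Even (orderOf (p : ZMod r))) (I : Ideal R) (hI : I ≠ ⊥) :
    Even (I.absNorm.factorization p) := by
  induction I using UniqueFactorizationMonoid.induction_on_prime with
  | h₁ => exact absurd rfl hI
  | h₂ u hu => rw [Ideal.isUnit_iff.mp hu]; simp
  | h₃ J P hJ hP ih =>
    have hP0 : P ≠ ⊥ := hP.ne_zero
    have hPp : P.IsPrime := Ideal.isPrime_of_prime hP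
    have hPm : P.IsMaximal := hPp.isMaximal hP0
    have hfin : Finite (R ⧸ P) :=
      (Ideal.absNorm_ne_zero_iff P).mp (Ideal.absNorm_eq_zero_iff.not.mpr hP0)
    rw [map_mul, Nat.factorization_mul (Ideal.absNorm_eq_zero_iff.not.mpr hP0)
      (Ideal.absNorm_eq_zero_iff.not.mpr hJ), Finsupp.add_apply]
    refine Even.add ?_ (ih hJ)
    let := Ideal.Quotient.field P
    obtain ⟨c, f, -, -, hc, hf⟩ := Ideal.exists_prime_and_absNorm_eq_pow P
    rw [hf, hc.factorization_pow]
    by_cases hcp : c = p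
    · subst hcp
      rw [Finsupp.single_eq_same]
      refine heven.trans_dvd ?_
      refine hζ.orderOf_dvd_of_card_eq_pow (Ideal.Quotient.mk P) hr ?_
        (by rw [← hf, Ideal.absNorm_apply, Submodule.cardQuot_apply])
      -- `P` contains `c ^ f`, which is coprime to `r`, so `r` cannot also vanish modulo `P`.
      intro h0
      have hc0 : ((c ^ f : ℕ) : R ⧸ P) = 0 := by
        rw [← hf, ← map_natCast (Ideal.Quotient.mk P)]
        exact Ideal.Quotient.eq_zero_iff_mem.mpr (Ideal.absNorm_mem P)
      have hcop : IsCoprime ((c ^ f : ℕ) : R ⧸ P) (r : R ⧸ P) :=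
        (hpr.pow_left f).cast
      rw [hc0, h0] at hcop
      simp at hcop
    · rw [Finsupp.single_eq_of_ne (Ne.symm hcp)]; simp

theorem odd_factorization_of_dvd_squarefreePart {p m : ℕ} (hp : p.Prime)
    (h : p ∣ squarefreePart m) : m ≠ 0 ∧ Odd (m.factorization p) := by
  obtain ⟨q, hq, hpq⟩ := (hp.prime.dvd_finsetProd_iff _).mp h
  rw [Finset.mem_filter] at hq
  have := (Nat.prime_dvd_prime_iff_eq hp (Nat.prime_of_mem_primeFactors hq.1)).mp hpq
  subst this
  exact ⟨(Nat.mem_primeFactors.mp hq.1).2.2, hq.2⟩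

theorem prime_modEq_one_of_odd_orderOf {p : ℕ} (hp : p.Prime) (hp2 : p ≠ 2)
    (h : Odd (orderOf (p : ZMod 4))) : p ≡ 1 [MOD 4] := by
  rcases (Nat.odd_mod_four_iff).mp (Nat.odd_iff.mp (hp.odd_of_ne_two hp2)) with h1 | h3
  · exact h1
  · exfalso
    have : (p : ZMod 4) = -1 := by
      rw [← ZMod.natCast_mod, h3]; decide
    rw [this, orderOf_eq_prime (p := 2) (by decide) (by decide)] at h
    exact absurd h (by decide)

/-- Norms of integers of a number field containing the `n`-th roots of unity, `4 ∣ n`. -/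
theorem restrictedSquarefreePart_natAbs_norm {K : Type*} [Field K] [NumberField K] {n : ℕ}
    (hn : 0 < n) (h4 : 4 ∣ n) {ζ : NumberField.RingOfIntegers K} (hζ : IsPrimitiveRoot ζ n)
    (x : NumberField.RingOfIntegers K) :
    RestrictedSquarefreePart n (Algebra.norm ℤ x).natAbs := by
  intro p hp hdvd
  obtain ⟨hm, hodd⟩ := odd_factorization_of_dvd_squarefreePart hp hdvd
  have key : ∀ r, r ∣ n → p.Coprime r → Odd (orderOf (p : ZMod r)) := by
    intro r hrn hpr
    by_contra hne
    obtain ⟨k, rfl⟩ := hrn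
    have hr : 0 < r := Nat.pos_of_mul_pos_right hn
    have hx : x ≠ 0 := by rintro rfl; simp at hm
    have := even_factorization_absNorm hp hr hpr (hζ.pow hn (mul_comm r k))
      (Nat.not_odd_iff_even.mp hne) (Ideal.span {x}) (by simpa using hx)
    rw [Ideal.absNorm_span_singleton] at this
    exact Nat.not_odd_iff_even.mpr this hodd
  refine ⟨or_iff_not_imp_left.mpr fun hp2 => prime_modEq_one_of_odd_orderOf hp hp2 (key 4 h4 ?_),
    fun q hq _ hqn => or_iff_not_imp_left.mpr fun hpq => key q hqn ?_⟩
  · exact Nat.Coprime.pow_right 2 ((Nat.coprime_primes hp Nat.prime_two).mpr hp2)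
  · exact (Nat.coprime_primes hp hq).mpr hpq

/-! ### Automorphisms of the cyclotomic field and the norm -/

theorem xi_isPrimitiveRoot {n : ℕ} (hn : n ≠ 0) : IsPrimitiveRoot (xi n) n :=
  Complex.isPrimitiveRoot_exp n hn

theorem xi_mul_pow {m n : ℕ} (hm : m ≠ 0) : xi (m * n) ^ m = xi n := by
  have : (m : ℂ) ≠ 0 := Nat.cast_ne_zero.mpr hm
  rw [xi, xi, ← Complex.exp_nat_mul]
  congr 1
  push_cast
  field_simp

theorem xi_four : xi 4 = Complex.I := by
  rw [xi, show 2 * (Real.pi : ℂ) * Complex.I / ((4 : ℕ) : ℂ) = Real.pi / 2 * Complex.I by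
    push_cast; ring, Complex.exp_pi_div_two_mul_I]

theorem conj_xi (n : ℕ) : starRingEnd ℂ (xi n) = (xi n)⁻¹ := by
  rw [xi, ← Complex.exp_conj, ← Complex.exp_neg]
  congr 1
  simp [neg_div, Complex.conj_ofNat]

instance Cyc.numberField (n : ℕ) : NumberField (Cyc n) where

instance Cyc.isCyclotomicExtension (n : ℕ) [NeZero n] : IsCyclotomicExtension {n} ℚ (Cyc n) := by
  change IsCyclotomicExtension {n} ℚ (Cyc n).toSubalgebra
  rw [IntermediateField.adjoin_simple_toSubalgebra_of_isAlgebraic (xi_isIntegral n).isAlgebraic]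
  exact (xi_isPrimitiveRoot (NeZero.ne n)).adjoin_isCyclotomicExtension ℚ

instance Cyc.isGalois (n : ℕ) [NeZero n] : IsGalois ℚ (Cyc n) :=
  IsCyclotomicExtension.isGalois {n} ℚ (Cyc n)

/-- The generator `ξ_n` of `ℚ(ξ_n)`. -/
noncomputable abbrev Cyc.gen (n : ℕ) : Cyc n := IntermediateField.AdjoinSimple.gen ℚ (xi n)

theorem Cyc.coe_gen (n : ℕ) : ((Cyc.gen n : Cyc n) : ℂ) = xi n :=
  IntermediateField.AdjoinSimple.coe_gen ℚ (xi n)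

theorem Cyc.gen_isPrimitiveRoot {n : ℕ} (hn : n ≠ 0) : IsPrimitiveRoot (Cyc.gen n) n :=
  IsPrimitiveRoot.of_map_of_injective (f := (Cyc n).val)
    (by simpa [Cyc.coe_gen] using xi_isPrimitiveRoot hn) (Cyc n).val.injective

/-- The exponent `k` with `ψ(ξ_n) = ξ_n^k`. -/
noncomputable abbrev Cyc.exponent (n : ℕ) [NeZero n] : (Cyc n ≃ₐ[ℚ] Cyc n) ≃* (ZMod n)ˣ :=
  IsCyclotomicExtension.Rat.galEquivZMod n (Cyc n)

theorem Cyc.apply_of_pow_eq_one {n : ℕ} [NeZero n] (ψ : Cyc n ≃ₐ[ℚ] Cyc n) {z : Cyc n}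
    (hz : z ^ n = 1) : ψ z = z ^ (Cyc.exponent n ψ).val.val :=
  IsCyclotomicExtension.Rat.galEquivZMod_apply_of_pow_eq n (Cyc n) ψ hz

/-- Complex conjugation on `ℚ(ξ_n)`. -/
noncomputable def Cyc.conj (n : ℕ) [NeZero n] : Cyc n ≃ₐ[ℚ] Cyc n :=
  (Complex.conjAe.restrictScalars ℚ).restrictNormal (Cyc n)

theorem Cyc.coe_conj {n : ℕ} [NeZero n] (x : Cyc n) :
    ((Cyc.conj n x : Cyc n) : ℂ) = starRingEnd ℂ x :=
  (Complex.conjAe.restrictScalars ℚ).restrictNormal_commutes (Cyc n) x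

/-- The Galois group is abelian; this is what turns `ψ (|x|²)` into `|ψ x|²`. -/
theorem Cyc.apply_conj {n : ℕ} [NeZero n] (ψ : Cyc n ≃ₐ[ℚ] Cyc n) (x : Cyc n) :
    ψ (Cyc.conj n x) = Cyc.conj n (ψ x) := by
  have := IsCyclotomicExtension.isMulCommutative {n} ℚ (Cyc n)
  exact DFunLike.congr_fun (mul_comm' ψ (Cyc.conj n)) x

theorem Cyc.coe_mul_conj {n : ℕ} [NeZero n] (x : Cyc n) :
    ((x * Cyc.conj n x : Cyc n) : ℂ) = ((‖(x : ℂ)‖ ^ 2 : ℝ) : ℂ) := by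
  push_cast
  rw [Cyc.coe_conj, Complex.mul_conj']

theorem ZMod.castHom_eq_natCast_val {m n : ℕ} [NeZero n] (h : m ∣ n) (a : ZMod n) :
    ZMod.castHom h (ZMod m) a = (a.val : ZMod m) := by
  conv_lhs => rw [← ZMod.natCast_zmod_val a]
  rw [map_natCast]

/-- The exponent of `ψ` is defined modulo `n`, and `4 ∣ n` gives it a class modulo `4`. -/
theorem mem_U4_iff {n : ℕ} [NeZero n] (h4 : 4 ∣ n) (ψ : Cyc n ≃ₐ[ℚ] Cyc n) :
    ψ ∈ U4 n ↔ ZMod.castHom h4 (ZMod 4) (Cyc.exponent n ψ).val = 1 := by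
  classical
  have hn := NeZero.ne n
  have hψ := Cyc.apply_of_pow_eq_one ψ (Cyc.gen_isPrimitiveRoot hn).pow_eq_one
  set u := Cyc.exponent n ψ
  rw [ZMod.castHom_eq_natCast_val, ← Nat.cast_one, ZMod.natCast_eq_natCast_iff]
  simp only [U4, Finset.mem_filter, Finset.mem_univ, true_and]
  rw [hψ]
  push_cast
  rw [Cyc.coe_gen]
  constructor
  · rintro ⟨j, -, hj⟩
    rw [((xi_isPrimitiveRoot hn).isOfFinOrder hn).pow_eq_pow_iff_modEq, ← (xi_isPrimitiveRoot hn).eq_orderOf] at hj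
    have := hj.of_dvd h4
    exact this.trans (by simp [Nat.ModEq])
  · intro h
    refine ⟨u.val.val / 4, ?_⟩
    have h1 : 4 * (u.val.val / 4) + 1 = u.val.val := by
      have : u.val.val % 4 = 1 := h
      omega
    rw [h1]
    exact ⟨ZMod.val_coe_unit_coprime u, rfl⟩

theorem ZMod.eq_one_or_neg_one_of_isUnit : ∀ a : ZMod 4, IsUnit a → a = 1 ∨ a = -1 := by
  decide

/-- The norm from `ℚ(ξ_n)`, `4 ∣ n`, as a product over `U_4`. -/
theorem prod_U4_mul_conj {n : ℕ} [NeZero n] (h4 : 4 ∣ n) (x : Cyc n) :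
    ∏ ψ ∈ U4 n, ψ (x * Cyc.conj n x) = ∏ ψ : Cyc n ≃ₐ[ℚ] Cyc n, ψ x := by
  classical
  have hn := NeZero.ne n
  have hc : (Cyc.exponent n (Cyc.conj n)) = -1 := by
    have h := Cyc.apply_of_pow_eq_one (Cyc.conj n) (Cyc.gen_isPrimitiveRoot hn).pow_eq_one
    set v := Cyc.exponent n (Cyc.conj n)
    have h1 : xi n ^ v.val.val * xi n = 1 := by
      have := congrArg (fun z : Cyc n => (z : ℂ)) h
      simp only [Cyc.coe_conj, Cyc.coe_gen, conj_xi] at this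
      push_cast at this
      rw [Cyc.coe_gen] at this
      rw [← this, inv_mul_cancel₀ ((xi_isPrimitiveRoot hn).ne_zero hn)]
    rw [← pow_succ, (xi_isPrimitiveRoot hn).pow_eq_one_iff_dvd, ← ZMod.natCast_eq_zero_iff] at h1
    push_cast at h1
    rw [ZMod.natCast_zmod_val] at h1
    ext
    simpa using eq_neg_of_add_eq_zero_left h1
  have hmul : ∀ ψ : Cyc n ≃ₐ[ℚ] Cyc n,
      ZMod.castHom h4 (ZMod 4) (Cyc.exponent n (ψ * Cyc.conj n)).val =
        -ZMod.castHom h4 (ZMod 4) (Cyc.exponent n ψ).val := by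
    intro ψ
    rw [map_mul, hc, Units.val_mul, map_mul, Units.val_neg, Units.val_one, map_neg, map_one,
      mul_neg_one]
  simp only [map_mul, Finset.prod_mul_distrib]
  rw [← Finset.prod_mul_prod_compl (U4 n) (fun ψ : Cyc n ≃ₐ[ℚ] Cyc n => ψ x)]
  congr 1
  have hcc : Cyc.conj n * Cyc.conj n = 1 := by
    apply (Cyc.exponent n).injective
    rw [map_mul, hc]; simp
  -- Conjugation has exponent `-1` and the units modulo `4` are `±1`, so multiplying by it swaps `U4
  -- n` and its complement.
  refine Finset.prod_nbij' (· * Cyc.conj n) (· * Cyc.conj n) ?_ ?_ ?_ ?_ ?_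
  · intro ψ hψ
    rw [mem_U4_iff h4] at hψ
    rw [Finset.mem_compl, mem_U4_iff h4, hmul, hψ]
    decide
  · intro ψ hψ
    rw [Finset.mem_compl, mem_U4_iff h4] at hψ
    rw [mem_U4_iff h4, hmul]
    rcases ZMod.eq_one_or_neg_one_of_isUnit _
      ((Cyc.exponent n ψ).isUnit.map (ZMod.castHom h4 (ZMod 4))) with h | h
    · exact absurd h hψ
    · rw [h, neg_neg]
  · intro ψ _; simp [mul_assoc, hcc]
  · intro ψ _; simp [mul_assoc, hcc]
  · intro ψ _; rfl

/-- The norm of an algebraic integer of `ℚ(ξ_n)`, `4 ∣ n`. -/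
theorem exists_norm_eq_natCast {n : ℕ} [NeZero n] (h4 : 4 ∣ n) (x : Cyc n)
    (hx : IsIntegral ℤ x) :
    ∃ m : ℕ, RestrictedSquarefreePart n m ∧ Algebra.norm ℚ x = (m : ℚ) ∧
      ∏ ψ : Cyc n ≃ₐ[ℚ] Cyc n, ψ x = (m : Cyc n) ∧
      ∏ ψ ∈ U4 n, ψ (x * Cyc.conj n x) = (m : Cyc n) := by
  have hn := NeZero.ne n
  obtain ⟨z, rfl⟩ : ∃ z : NumberField.RingOfIntegers (Cyc n), algebraMap _ (Cyc n) z = x :=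
    ⟨⟨x, hx⟩, rfl⟩
  set x := algebraMap (NumberField.RingOfIntegers (Cyc n)) (Cyc n) z with hxz
  obtain ⟨ζ, hζ⟩ : ∃ ζ : NumberField.RingOfIntegers (Cyc n), IsPrimitiveRoot ζ n :=
    ⟨_, (Cyc.gen_isPrimitiveRoot hn).toInteger_isPrimitiveRoot⟩
  have hN : Algebra.norm ℚ x = ((Algebra.norm ℤ z : ℤ) : ℚ) :=
    (Algebra.coe_norm_int z).symm
  have hprod := Algebra.norm_eq_prod_automorphisms ℚ x
  -- The norm is a product of squared absolute values over `U4 n`.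
  have hnonneg : 0 ≤ Algebra.norm ℤ z := by
    have h1 : ((Algebra.norm ℤ z : ℤ) : ℂ) =
        ((∏ ψ ∈ U4 n, ‖((ψ x : Cyc n) : ℂ)‖ ^ 2 : ℝ) : ℂ) := by
      rw [Complex.ofReal_prod]
      simp only [← Cyc.coe_mul_conj, ← Cyc.apply_conj, ← map_mul]
      have h2 := (prod_U4_mul_conj h4 x).trans hprod.symm
      rw [hN] at h2
      have h3 := congrArg (fun z : Cyc n => (z : ℂ)) h2
      simpa using h3.symm
    have h2 : ((Algebra.norm ℤ z : ℤ) : ℝ) = ∏ ψ ∈ U4 n, ‖((ψ x : Cyc n) : ℂ)‖ ^ 2 := by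
      exact_mod_cast h1
    have h3 : (0 : ℝ) ≤ ((Algebra.norm ℤ z : ℤ) : ℝ) := by rw [h2]; positivity
    exact_mod_cast h3
  have hm : Algebra.norm ℚ x = (((Algebra.norm ℤ z).natAbs : ℕ) : ℚ) := by
    rw [hN, Nat.cast_natAbs, abs_of_nonneg hnonneg]
  have hm' : ∏ ψ : Cyc n ≃ₐ[ℚ] Cyc n, ψ x = (((Algebra.norm ℤ z).natAbs : ℕ) : Cyc n) := by
    rw [← hprod, hm, map_natCast]
  exact ⟨_, restrictedSquarefreePart_natAbs_norm (Nat.pos_of_ne_zero hn) h4 hζ z, hm, hm',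
    (prod_U4_mul_conj h4 x).trans hm'⟩

/-! ### Quaternary sequences and their spectra -/

theorem IsQuaternary.conj {ℓ : ℕ} {A : ZMod ℓ → ℂ} (hA : IsQuaternary A) :
    IsQuaternary fun j => starRingEnd ℂ (A j) := by
  intro j
  rcases hA j with h | h | h | h <;> simp [h]

/-- `i = ξ_n^(n/4)` lies in the field, and an automorphism with exponent `1` modulo `4` fixes it
because `i ^ 4 = 1`. -/
theorem IsQuaternary.exists_lift {ℓ : ℕ} {A : ZMod ℓ → ℂ} (hA : IsQuaternary A) {n : ℕ} [NeZero n]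
    (h4 : 4 ∣ n) (j : ZMod ℓ) :
    ∃ a : Cyc n, (a : ℂ) = A j ∧ IsIntegral ℤ a ∧ ∀ ψ ∈ U4 n, ψ a = a := by
  have hn := NeZero.ne n
  have hprim := Cyc.gen_isPrimitiveRoot hn
  set z : Cyc n := Cyc.gen n ^ (n / 4) with hz
  have hz4 : z ^ 4 = 1 := by rw [hz, ← pow_mul, Nat.div_mul_cancel h4, hprim.pow_eq_one]
  have hzI : (z : ℂ) = Complex.I := by
    have h0 : n / 4 ≠ 0 :=
      (Nat.div_pos (Nat.le_of_dvd (Nat.pos_of_ne_zero hn) h4) (by norm_num)).ne'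
    have h := xi_mul_pow (n := 4) h0
    rw [Nat.div_mul_cancel h4, xi_four] at h
    rw [hz]
    push_cast
    rw [Cyc.coe_gen, h]
  have hzint : IsIntegral ℤ z := IsIntegral.of_pow (n := 4) (by norm_num) (hz4 ▸ isIntegral_one)
  have hzfix : ∀ ψ ∈ U4 n, ψ z = z := by
    intro ψ hψ
    rw [mem_U4_iff h4, ZMod.castHom_eq_natCast_val, ← Nat.cast_one,
      ZMod.natCast_eq_natCast_iff] at hψ
    have hzn : z ^ n = 1 := by rw [hz, pow_right_comm, hprim.pow_eq_one, one_pow]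
    rw [Cyc.apply_of_pow_eq_one ψ hzn]
    conv_lhs => rw [← Nat.mod_add_div (Cyc.exponent n ψ).val.val 4, pow_add, pow_mul, hz4, one_pow,
      mul_one, show (Cyc.exponent n ψ).val.val % 4 = 1 from hψ, pow_one]
  rcases hA j with h | h | h | h
  · exact ⟨1, by simp [h], isIntegral_one, by simp⟩
  · exact ⟨-1, by simp [h], isIntegral_one.neg, by simp⟩
  · exact ⟨z, by rw [h, hzI], hzint, hzfix⟩
  · exact ⟨-z, by rw [h, ← hzI]; simp, hzint.neg, fun ψ hψ => by rw [map_neg, hzfix ψ hψ]⟩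

section DFT

variable {ℓ : ℕ} [NeZero ℓ] {d : ℕ}

theorem DFT_mul_div (A : ZMod ℓ → ℂ) (hd : d ∣ ℓ) (k : ℕ) :
    DFT A (k * (ℓ / d)) = ∑ j : ZMod ℓ, A j * xi d ^ (j.val * k) := by
  have h0 : ℓ / d ≠ 0 := (Nat.div_pos (Nat.le_of_dvd (NeZero.pos ℓ) hd)
    (Nat.pos_of_dvd_of_pos hd (NeZero.pos ℓ))).ne'
  have h : xi ℓ ^ (ℓ / d) = xi d := by
    conv_lhs => enter [1]; rw [← Nat.div_mul_cancel hd]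
    exact xi_mul_pow h0
  refine Finset.sum_congr rfl fun j _ => ?_
  rw [← h, ← pow_mul]
  ring_nf

theorem xi_pow_eq_of_modEq {d : ℕ} (hd : d ≠ 0) {a b : ℕ} (h : a ≡ b [MOD d]) :
    xi d ^ a = xi d ^ b := by
  rw [((xi_isPrimitiveRoot hd).isOfFinOrder hd).pow_eq_pow_iff_modEq,
    ← (xi_isPrimitiveRoot hd).eq_orderOf]
  exact h

theorem PSD_mul_div_congr (A : ZMod ℓ → ℂ) (hd : d ∣ ℓ) {a b : ℕ} (h : a ≡ b [MOD d]) :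
    PSD A (a * (ℓ / d)) = PSD A (b * (ℓ / d)) := by
  have hd0 : d ≠ 0 := (Nat.pos_of_dvd_of_pos hd (NeZero.pos ℓ)).ne'
  rw [PSD, PSD, DFT_mul_div A hd, DFT_mul_div A hd]
  simp only [xi_pow_eq_of_modEq hd0 (h.mul_left _)]

/-- Conjugating the entries conjugates the DFT and negates the frequency. -/
theorem PSD_conj_mul_div (A : ZMod ℓ → ℂ) (hd : d ∣ ℓ) {a b : ℕ} (h : d ∣ a + b) :
    PSD (fun j => starRingEnd ℂ (A j)) (a * (ℓ / d)) = PSD A (b * (ℓ / d)) := by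
  have hd0 : d ≠ 0 := (Nat.pos_of_dvd_of_pos hd (NeZero.pos ℓ)).ne'
  have key : DFT (fun j => starRingEnd ℂ (A j)) (a * (ℓ / d)) =
      starRingEnd ℂ (DFT A (b * (ℓ / d))) := by
    rw [DFT_mul_div _ hd, DFT_mul_div _ hd, map_sum]
    refine Finset.sum_congr rfl fun j _ => ?_
    rw [map_mul, map_pow, conj_xi, inv_pow]
    congr 1
    apply eq_inv_of_mul_eq_one_left
    rw [← pow_add, ← mul_add, (xi_isPrimitiveRoot hd0).pow_eq_one_iff_dvd]
    exact h.mul_left _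
  rw [PSD, PSD, key, Complex.norm_conj]

/-- `U4 n` fixes the coefficients, so `ψ` acts only on the powers of `ξ_d`. -/
theorem IsQuaternary.exists_DFT_lift {A : ZMod ℓ → ℂ} (hA : IsQuaternary A) (hd : d ∣ ℓ)
    {n : ℕ} [NeZero n] (h4 : 4 ∣ n) (hdn : d ∣ n) (s : ℕ) :
    ∃ x : Cyc n, (x : ℂ) = DFT A (s * (ℓ / d)) ∧ IsIntegral ℤ x ∧ ∀ ψ ∈ U4 n,
      ((ψ x : Cyc n) : ℂ) = DFT A ((Cyc.exponent n ψ).val.val * s * (ℓ / d)) := by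
  have hn := NeZero.ne n
  have hprim := Cyc.gen_isPrimitiveRoot hn
  choose a haA haint hafix using hA.exists_lift h4
  set z : Cyc n := Cyc.gen n ^ (n / d) with hz
  have hzn : z ^ n = 1 := by rw [hz, pow_right_comm, hprim.pow_eq_one, one_pow]
  have hzint : IsIntegral ℤ z :=
    IsIntegral.of_pow (Nat.pos_of_ne_zero hn) (hzn ▸ isIntegral_one)
  have hzc : (z : ℂ) = xi d := by
    have h0 : n / d ≠ 0 := (Nat.div_pos (Nat.le_of_dvd (NeZero.pos n) hdn)
      (Nat.pos_of_dvd_of_pos hdn (NeZero.pos n))).ne'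
    have h := xi_mul_pow (n := d) h0
    rw [Nat.div_mul_cancel hdn] at h
    rw [hz]
    push_cast
    rw [Cyc.coe_gen, h]
  refine ⟨∑ j, a j * z ^ (j.val * s), ?_, ?_, ?_⟩
  · rw [DFT_mul_div A hd]
    push_cast
    simp only [haA, hzc]
  · exact IsIntegral.sum _ fun j _ => (haint j).mul (hzint.pow _)
  · intro ψ hψ
    rw [DFT_mul_div A hd, map_sum]
    push_cast
    refine Finset.sum_congr rfl fun j _ => ?_
    rw [map_mul, map_pow, hafix j ψ hψ, Cyc.apply_of_pow_eq_one ψ hzn, ← pow_mul]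
    push_cast
    rw [haA, hzc]
    congr 2
    ring

/-- The units of `ZMod n` that reduce to `s` modulo `4`. -/
def unitsOver (n : ℕ) (h4 : 4 ∣ n) [NeZero n] (s : ZMod 4) : Finset (ZMod n)ˣ :=
  Finset.univ.filter fun u => ZMod.castHom h4 (ZMod 4) u.val = s

theorem mem_unitsOver {n : ℕ} {h4 : 4 ∣ n} [NeZero n] {s : ZMod 4} {u : (ZMod n)ˣ} :
    u ∈ unitsOver n h4 s ↔ ZMod.castHom h4 (ZMod 4) u.val = s := by
  simp only [unitsOver, Finset.mem_filter, Finset.mem_univ, true_and]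

theorem prod_unitsOver {M : Type*} [CommMonoid M] {n : ℕ} [NeZero n] (h4 : 4 ∣ n) {s : ℕ}
    (hs : s < 4) (f : ℕ → M) :
    ∏ u ∈ unitsOver n h4 s, f u.val.val =
      ∏ j ∈ (Finset.range (n / 4)).filter (fun j => Nat.gcd (4 * j + s) n = 1), f (4 * j + s) := by
  have hmod : ∀ u ∈ unitsOver n h4 s, 4 * (u.val.val / 4) + s = u.val.val := by
    intro u hu
    rw [mem_unitsOver, ZMod.castHom_eq_natCast_val, ZMod.natCast_eq_natCast_iff] at hu
    have : u.val.val % 4 = s % 4 := hu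
    omega
  refine Finset.prod_bij (fun u _ => u.val.val / 4) ?_ ?_ ?_ ?_
  · intro u hu
    rw [Finset.mem_filter, Finset.mem_range, hmod u hu]
    exact ⟨Nat.div_lt_div_of_lt_of_dvd h4 (ZMod.val_lt u.val), ZMod.val_coe_unit_coprime u⟩
  · intro u hu v hv h
    have h1 := hmod u hu
    rw [h, hmod v hv] at h1
    exact Units.ext (ZMod.val_injective n h1.symm)
  · intro j hj
    rw [Finset.mem_filter, Finset.mem_range] at hj
    -- No wrap-around occurs: `j < n / 4` and `s < 4`.
    have hlt : 4 * j + s < n := by omega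
    have hval : (ZMod.unitOfCoprime (4 * j + s) hj.2).val.val = 4 * j + s := by
      rw [ZMod.coe_unitOfCoprime, ZMod.val_cast_of_lt hlt]
    refine ⟨ZMod.unitOfCoprime (4 * j + s) hj.2, ?_, ?_⟩
    · rw [mem_unitsOver, ZMod.castHom_eq_natCast_val, hval]
      push_cast
      rw [show (4 : ZMod 4) = 0 from rfl, zero_mul, zero_add]
    · rw [hval]
      omega
  · intro u hu
    rw [hmod u hu]

theorem psdProd_eq_prod_unitsOver (A : ZMod ℓ → ℂ) (hd : d ∣ ℓ) {n : ℕ} [NeZero n] (h4 : 4 ∣ n)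
    {s : ℕ} (hs : s < 4) :
    psdProd A d n s = ∏ u ∈ unitsOver n h4 s, PSD A (u.val.val * (ℓ / d)) := by
  rw [prod_unitsOver h4 hs (fun k => PSD A (k * (ℓ / d))), psdProd]
  exact Finset.prod_congr rfl fun j _ => PSD_mul_div_congr A hd (Nat.mod_modEq _ _)

theorem IsQuaternary.exists_normDFTEq {A : ZMod ℓ → ℂ} (hA : IsQuaternary A) (hd : d ∣ ℓ)
    {n : ℕ} [NeZero n] (h4 : 4 ∣ n) (hdn : d ∣ n) (s : ℕ) :
    ∃ m : ℕ, NormDFTEq A n (s * (ℓ / d)) m ∧ RestrictedSquarefreePart n m ∧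
      ∏ u ∈ unitsOver n h4 1, PSD A (u.val.val * s * (ℓ / d)) = (m : ℝ) := by
  obtain ⟨x, hx, hxint, hxψ⟩ := hA.exists_DFT_lift hd h4 hdn s
  obtain ⟨m, hm, hnorm, hprod, hU⟩ := exists_norm_eq_natCast h4 x hxint
  refine ⟨m, ⟨x, x * Cyc.conj n x, hx, ?_, hnorm, hprod, hU⟩, hm, ?_⟩
  · rw [Cyc.coe_mul_conj, hx, PSD]
  · have h := congrArg (fun z : Cyc n => (z : ℂ)) hU
    have h1 : ∏ ψ ∈ U4 n, PSD A ((Cyc.exponent n ψ).val.val * s * (ℓ / d)) = (m : ℝ) := by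
      apply Complex.ofReal_injective
      rw [Complex.ofReal_prod]
      refine Eq.trans ?_ (h.trans (by simp))
      push_cast
      refine Finset.prod_congr rfl fun ψ hψ => ?_
      rw [map_mul, Cyc.apply_conj, Cyc.coe_mul_conj, hxψ ψ hψ, PSD]
    rw [← h1]
    exact (Finset.prod_equiv (Cyc.exponent n).toEquiv
      (fun ψ => by rw [mem_U4_iff h4, mem_unitsOver]; rfl) (fun ψ _ => rfl)).symm

/-- The substitution `u ↦ -u` exchanges the classes `1` and `3` modulo `4`. It needs no condition at
`3`, so it also covers `3 ∣ d`. -/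
theorem psdProd_three_eq_conj (A : ZMod ℓ → ℂ) (hd : d ∣ ℓ) {n : ℕ} [NeZero n] (h4 : 4 ∣ n)
    (hdn : d ∣ n) :
    psdProd A d n 3 = psdProd (fun j => starRingEnd ℂ (A j)) d n 1 := by
  rw [psdProd_eq_prod_unitsOver A hd h4 (by norm_num),
    psdProd_eq_prod_unitsOver _ hd h4 (by norm_num)]
  refine Finset.prod_equiv (Equiv.neg _) (fun u => ?_) (fun u _ => ?_)
  · rw [mem_unitsOver, mem_unitsOver, Equiv.neg_apply, Units.val_neg, map_neg, neg_eq_iff_eq_neg]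
    rw [show ((3 : ℕ) : ZMod 4) = -((1 : ℕ) : ZMod 4) by decide]
  · refine (PSD_conj_mul_div A hd (hdn.trans ?_)).symm
    rw [← ZMod.natCast_eq_zero_iff]
    push_cast
    rw [ZMod.natCast_zmod_val, ZMod.natCast_zmod_val, Equiv.neg_apply, Units.val_neg,
      neg_add_cancel]

/-- For `3 ∤ d`, multiplication by `3` permutes the units modulo `d` and exchanges the classes `1`
and `3` modulo `4`. -/
theorem prod_PSD_mul_three (A : ZMod ℓ → ℂ) [NeZero d] (hd : d ∣ ℓ) (h4 : 4 ∣ d) (h3 : ¬ 3 ∣ d) :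
    ∏ u ∈ unitsOver d h4 1, PSD A (u.val.val * 3 * (ℓ / d)) = psdProd A d d 3 := by
  rw [psdProd_eq_prod_unitsOver A hd h4 (by norm_num)]
  have hcop : Nat.Coprime 3 d := (Nat.Prime.coprime_iff_not_dvd Nat.prime_three).mpr h3
  refine Finset.prod_equiv (Equiv.mulRight (ZMod.unitOfCoprime 3 hcop))
    (fun u => ?_) (fun u _ => ?_)
  · rw [mem_unitsOver, mem_unitsOver, Equiv.coe_mulRight, Units.val_mul, map_mul,
      ZMod.coe_unitOfCoprime, map_natCast]
    generalize ZMod.castHom h4 (ZMod 4) u.val = a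
    revert a
    decide
  · refine PSD_mul_div_congr A hd ?_
    rw [← ZMod.natCast_eq_natCast_iff]
    push_cast
    rw [ZMod.natCast_zmod_val, ZMod.natCast_zmod_val, Equiv.coe_mulRight, Units.val_mul,
      ZMod.coe_unitOfCoprime]
    rfl

end DFT

/-! ### The main theorem -/

theorem mainTheorem1 (ℓ : ℕ) [NeZero ℓ] (A B : ZMod ℓ → ℂ)
    (hAB : IsQuaternaryLegendrePair A B)
    (d : ℕ) (hd1 : 1 < d) (hd : d ∣ ℓ) (n : ℕ) (hn : n = Nat.lcm 4 d) :
    (∃ m : ℕ, NormDFTEq A n (ℓ / d) m ∧ psdProd A d n 1 = (m : ℝ) ∧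
      RestrictedSquarefreePart n m) ∧
    (4 ∣ d →
      (∃ m : ℕ, psdProd A d n 3 = (m : ℝ) ∧ RestrictedSquarefreePart n m ∧
        (¬ 3 ∣ d → NormDFTEq A n (3 * (ℓ / d)) m)) ∧
      (∃ m : ℕ, NormDFTEq A n (3 * (ℓ / d)) m ∧ RestrictedSquarefreePart n m)) := by
  have hA := hAB.quaternary_left
  have h4 : 4 ∣ n := hn ▸ Nat.dvd_lcm_left 4 d
  have hdn : d ∣ n := hn ▸ Nat.dvd_lcm_right 4 d
  have : NeZero n := ⟨hn ▸ Nat.lcm_ne_zero (by norm_num) (by omega)⟩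
  have one : ∀ C : ZMod ℓ → ℂ, IsQuaternary C → ∃ m : ℕ, NormDFTEq C n (ℓ / d) m ∧
      psdProd C d n 1 = (m : ℝ) ∧ RestrictedSquarefreePart n m := by
    intro C hC
    obtain ⟨m, hm, hres, hprod⟩ := hC.exists_normDFTEq hd h4 hdn 1
    rw [one_mul] at hm
    refine ⟨m, hm, ?_, hres⟩
    rw [psdProd_eq_prod_unitsOver C hd h4 (by norm_num), ← hprod, Nat.cast_one]
    simp only [mul_one]
  refine ⟨one A hA, fun h4d => ?_⟩
  obtain ⟨m, hm, hres, hprod⟩ := hA.exists_normDFTEq hd h4 hdn 3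
  refine ⟨?_, m, hm, hres⟩
  -- If `3 ∣ d`, the product is realised as a norm for the conjugate sequence at frequency `1`;
  -- otherwise it is the norm for `A` at frequency `3`.
  by_cases h3 : 3 ∣ d
  · obtain ⟨m', -, hpsd, hres'⟩ := one _ hA.conj
    exact ⟨m', (psdProd_three_eq_conj A hd h4 hdn).trans hpsd, hres', fun h => absurd h3 h⟩
  · obtain rfl : n = d := hn.trans (Nat.lcm_eq_right h4d)
    exact ⟨m, (prod_PSD_mul_three A hd h4 h3).symm.trans hprod, hres, fun _ => hm⟩
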